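/- Let $\ell\ge 2$ be an integer and let $p_1,\dots,p_\ell\in\mathbb Z[x]$ be linearly independent polynomials with zero constant term. Then there are a probability space $(X,\mathcal A,\nu)$, an invertible measure-preserving transformation $T:X\to X$ (a bijection with $T$ and $T^{-1}$ measurable and $\nu(T^{-1}B)=\nu(B)$ for all $B\in\mathcal A$), a set $A\in\mathcal A$ with $\nu(A)>0$, and an $\epsilon>0$ such that the set $$R=\{n\in\mathbb Z : \nu(A\cap T^{-p_1(n)}A\cap\cdots\cap T^{-p_\ell(n)}A)>\nu(A)^{\ell+1}-\epsilon\}$$ is not IP$^*$. Here a set $E\subseteq\mathbb Z$ is called IP$^*$ if for every strictly monotone (strictly increasing or strictly decreasing) sequence $(n_k)_{k\in\mathbb N}$ in $\mathbb Z$ one has $$E\cap\{n_{k_1}+\cdots+n_{k_t} : t\in\mathbb N,\ t\ge 1,\ k_1<\cdots<k_t\}\ne\emptyset.$$ -/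

import Mathlib

open MeasureTheory Polynomial

/-- The set of all finite sums `n_{k₁} + ⋯ + n_{k_t}` with `k₁ < ⋯ < k_t` and `t ≥ 1`. -/
def finiteSums (n : ℕ → ℤ) : Set ℤ :=
  {m | ∃ α : Finset ℕ, α.Nonempty ∧ m = ∑ k ∈ α, n k}

/-- A set of integers is IP* if it meets the set of finite sums of every strictly monotone
(that is, strictly increasing or strictly decreasing) sequence of integers. -/
def IsIPStar (E : Set ℤ) : Prop :=
  ∀ n : ℕ → ℤ, (StrictMono n ∨ StrictAnti n) → (E ∩ finiteSums n).Nonempty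

/-- The set `T^{-m} A`, for an integer `m`: the points that the `m`-th iterate of the invertible
map `T` sends into `A` (for negative `m`, an iterate of the inverse of `T`). -/
def iteratePreimage {X : Type*} [MeasurableSpace X] (T : X ≃ᵐ X) (m : ℤ) (A : Set X) : Set X :=
  ((T.toEquiv : Equiv.Perm X) ^ m) ⁻¹' A

/-- The set of integers `n` for which
`ν (A ∩ T^{-p₁(n)} A ∩ ⋯ ∩ T^{-p_ℓ(n)} A) > ν(A)^{ℓ+1} - ε`. -/
def largeReturns {X : Type*} [MeasurableSpace X] (ν : Measure X) (T : X ≃ᵐ X)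
    {ℓ : ℕ} (p : Fin ℓ → ℤ[X]) (A : Set X) (ε : ℝ) : Set ℤ :=
  {n | ν.real (A ∩ ⋂ j : Fin ℓ, iteratePreimage T ((p j).eval n) A) > ν.real A ^ (ℓ + 1) - ε}

/-! The system is a random rotation: `T (ξ, w) = (ξ, w + θ ξ)` on `(ℕ → ZMod q) × UnitAddCircle`,
and `A` is the complement of an arc of length `κ` in the circle coordinate. With `n k` growing fast,
`θ ξ` is a sum of small independent increments, designed so that for every finite sum `m` of the `n
k`, `k ∈ α`, one has `p j (m) • θ ξ ≈ u * g * (j + 1) / q` modulo 1, where `u = ∑ k ∈ α, ξ k`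
(`exists_seq_increment_approx`). Linear independence allows prescribing the values `g * (j + 1)`
(`exists_functional_of_linearIndependent`).

For `q` a large prime, `u` is nonzero modulo `q` with probability `1 - 1 / q`. The `ℓ + 1`
translates of the arc are then disjoint and their union has the largest possible measure. Hence the
intersection has measure at most `1 - (ℓ + 1) κ + ℓ κ / q`, which is below `(1 - κ) ^ (ℓ + 1)` for
`κ` slightly less than `1 / q` (`exists_arc_length`). The gap is `ε`, uniform in `α`. -/

/-! ### Fast growing sequences -/

/-- A sequence growing as fast as wanted, in terms of the sum of the preceding terms, with
prescribed divisibility. -/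
lemma exists_fast_growing_seq (q D : ℕ) (hq : 2 ≤ q) (hD : 1 ≤ D) (b : ℕ → ℕ) :
    ∃ n : ℕ → ℕ, StrictMono n ∧ (∀ k, 0 < n k) ∧ (∀ k, q ∣ n k) ∧
      (∀ k, q * n k ^ D ∣ n (k + 1)) ∧
      ∀ k, 2 ^ k * b (∑ i ∈ Finset.range k, n i) ≤ n k := by
  -- The state carries the current term and the sum of all terms so far.
  let st : ℕ → ℕ × ℕ := fun k => Nat.rec (q * (b 0 + 1), q * (b 0 + 1))
    (fun k s => (q * s.1 ^ D * (2 ^ (k + 1) * b s.2 + 1),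
      s.2 + q * s.1 ^ D * (2 ^ (k + 1) * b s.2 + 1))) k
  have h1 : ∀ k, (st (k + 1)).1 = q * (st k).1 ^ D * (2 ^ (k + 1) * b (st k).2 + 1) :=
    fun k => rfl
  have h2 : ∀ k, (st k).2 = ∑ i ∈ Finset.range (k + 1), (st i).1 := by
    intro k
    induction k with
    | zero => simp [st]
    | succ k ih => rw [Finset.sum_range_succ, ← ih]
  have hq0 : 0 < q := by omega
  have hpos : ∀ k, 0 < (st k).1 := by
    intro k
    induction k with
    | zero => exact Nat.mul_pos hq0 (Nat.succ_pos _)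
    | succ k ih => rw [h1]; positivity
  have hone : ∀ k, (st k).1 ≤ (st k).1 ^ D := fun k => Nat.le_self_pow (by omega) _
  refine ⟨fun k => (st k).1, strictMono_nat_of_lt_succ fun k => ?_, hpos, fun k => ?_,
    fun k => ?_, fun k => ?_⟩
  · rw [h1]
    calc (st k).1 < 2 * (st k).1 * 1 := by have := hpos k; omega
      _ ≤ _ := by gcongr; exacts [hone k, Nat.le_add_left _ _]
  · cases k with
    | zero => exact Dvd.intro _ rfl
    | succ k => simp only [h1, mul_assoc]; exact Dvd.intro _ rfl
  · simp only [h1]; exact Dvd.intro _ rfl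
  · cases k with
    | zero =>
      change 2 ^ 0 * b (∑ i ∈ Finset.range 0, (st i).1) ≤ q * (b 0 + 1)
      rw [Finset.range_zero, Finset.sum_empty, pow_zero, one_mul]
      exact (Nat.le_succ _).trans (Nat.le_mul_of_pos_left _ hq0)
    | succ k =>
      simp only [← h2, h1]
      exact (Nat.le_succ _).trans
        (Nat.le_mul_of_pos_left _ (by have := hpos k; positivity))

/-! ### The norm on the circle -/

lemma UnitAddCircle.norm_coe_le (x : ℝ) : ‖(x : UnitAddCircle)‖ ≤ |x| := by
  rw [UnitAddCircle.norm_eq]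
  simpa using round_le x 0

lemma UnitAddCircle.coe_intCast (z : ℤ) : ((z : ℝ) : UnitAddCircle) = 0 := by
  rw [← zsmul_one z, AddCircle.coe_zsmul, AddCircle.coe_period, smul_zero]

lemma UnitAddCircle.coe_eq_zero_of_dvd {q a : ℤ} (h : q ∣ a) :
    ((a / q : ℝ) : UnitAddCircle) = 0 := by
  obtain ⟨c, rfl⟩ := h
  by_cases hq : (q : ℝ) = 0
  · simp [hq]
  · rw [← UnitAddCircle.coe_intCast c]
    congr 1
    push_cast
    field_simp

lemma UnitAddCircle.inv_le_norm_coe {q a : ℤ} (hq : 0 < q) (h : ¬ q ∣ a) :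
    1 / (q : ℝ) ≤ ‖((a / q : ℝ) : UnitAddCircle)‖ := by
  rw [UnitAddCircle.norm_eq]
  set r := round (a / q : ℝ)
  have hq' : (0 : ℝ) < q := by exact_mod_cast hq
  have : (a / q : ℝ) - r = ((a - q * r : ℤ) : ℝ) / q := by push_cast; field_simp
  rw [this, abs_div, abs_of_pos hq']
  gcongr
  have h0 : a - q * r ≠ 0 := fun h0 => h ⟨r, by linarith⟩
  exact_mod_cast Int.one_le_abs h0

/-! ### Rotation increments and polynomial values modulo 1 -/

/-- The rotation increment `(t / q) ∑ y_d n^{-d}`. -/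
noncomputable def increment (q D : ℕ) (y : ℕ → ℤ) (n : ℕ) (t : ℤ) : ℝ :=
  (t / q) * ∑ d ∈ Finset.range (D + 1), (y d : ℝ) / (n : ℝ) ^ d

section increment

variable {q D : ℕ} {y : ℕ → ℤ} {n : ℕ} {t : ℤ}

lemma abs_increment_le (hy : y 0 = 0) (hn : 0 < n) (ht : |(t / q : ℝ)| ≤ 1) :
    |increment q D y n t| ≤ (∑ d ∈ Finset.range (D + 1), |(y d : ℝ)|) / n := by
  rw [increment, abs_mul, Finset.sum_div]
  refine (mul_le_of_le_one_left (abs_nonneg _) ht).trans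
    ((Finset.abs_sum_le_sum_abs _ _).trans (Finset.sum_le_sum fun d _ => ?_))
  have hn1 : (1 : ℝ) ≤ n := by exact_mod_cast hn
  rcases Nat.eq_zero_or_pos d with rfl | hd
  · simp [hy]
  · rw [abs_div, abs_of_pos (by positivity : (0 : ℝ) < (n : ℝ) ^ d)]
    gcongr
    exact le_self_pow₀ hn1 hd.ne'

/-- The factor `q * n ^ D` clears every denominator. This makes the terms of the sequence after `n`
irrelevant. -/
lemma coe_mul_increment_eq_zero {m : ℤ} (hq : 0 < q) (hn : 0 < n)
    (hm : (q : ℤ) * (n : ℤ) ^ D ∣ m) :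
    ((m * increment q D y n t : ℝ) : UnitAddCircle) = 0 := by
  obtain ⟨c, rfl⟩ := hm
  rw [← UnitAddCircle.coe_intCast
    (c * t * ∑ d ∈ Finset.range (D + 1), y d * (n : ℤ) ^ (D - d))]
  congr 1
  rw [increment]
  push_cast
  have : ∑ d ∈ Finset.range (D + 1), (y d : ℝ) * (n : ℝ) ^ (D - d) =
      n ^ D * ∑ d ∈ Finset.range (D + 1), (y d : ℝ) / (n : ℝ) ^ d := by
    rw [Finset.mul_sum]
    refine Finset.sum_congr rfl fun d hd => ?_
    rw [pow_sub₀ _ (by positivity) (by simpa [Nat.lt_succ_iff] using hd)]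
    field_simp
  rw [this]
  field_simp

/-- Multiplication by `n ^ e` isolates `y e`: terms with `d < e` become integers since `q ∣ n`, and
terms with `d > e` are `O(1 / n)`. -/
lemma norm_coe_pow_mul_increment_sub_le {e : ℕ} (hqn : q ∣ n) (hn : 0 < n)
    (ht : |(t / q : ℝ)| ≤ 1) (he : e ≤ D) :
    ‖(((n : ℝ) ^ e * increment q D y n t - t * y e / q : ℝ) : UnitAddCircle)‖ ≤
      (∑ d ∈ Finset.range (D + 1), |(y d : ℝ)|) / n := by
  have hn1 : (1 : ℝ) ≤ n := by exact_mod_cast hn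
  have hsum : (n : ℝ) ^ e * increment q D y n t - t * y e / q =
      ∑ d ∈ Finset.range (D + 1), ((t / q : ℝ) * y d * (n ^ e / n ^ d) -
        if d = e then (t * y e / q : ℝ) else 0) := by
    rw [Finset.sum_sub_distrib, Finset.sum_ite_eq' _ e,
      if_pos (Finset.mem_range.2 (Nat.lt_succ_of_le he)), increment, Finset.mul_sum,
      Finset.mul_sum]
    congr 1
    refine Finset.sum_congr rfl fun d _ => ?_
    ring
  rw [hsum, Finset.sum_div]
  change ‖(QuotientAddGroup.mk' _) (∑ d ∈ Finset.range (D + 1), _)‖ ≤ _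
  rw [map_sum]
  refine norm_sum_le_of_le _ fun d _ => ?_
  change ‖((_ : ℝ) : UnitAddCircle)‖ ≤ _
  rcases lt_trichotomy d e with h | rfl | h
  · rw [if_neg h.ne, sub_zero]
    obtain ⟨c, rfl⟩ := hqn
    have hq0 : (q : ℝ) ≠ 0 := by rintro h0; simp [Nat.cast_eq_zero.1 h0] at hn
    have : (t / q : ℝ) * y d * (((q * c : ℕ) : ℝ) ^ e / ((q * c : ℕ) : ℝ) ^ d) =
        ((t * y d * c * (q * c) ^ (e - d - 1) : ℤ) : ℝ) := by
      obtain ⟨f, rfl⟩ := Nat.exists_eq_add_of_lt h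
      rw [show d + f + 1 - d - 1 = f by omega]
      have hc0 : (c : ℝ) ≠ 0 := by rintro h0; simp [Nat.cast_eq_zero.1 h0] at hn
      push_cast
      field_simp
      ring
    rw [this, UnitAddCircle.coe_intCast, norm_zero]
    positivity
  · rw [if_pos rfl, div_self (by positivity), mul_one, div_mul_eq_mul_div, sub_self,
      AddCircle.coe_zero, norm_zero]
    positivity
  · rw [if_neg h.ne', sub_zero]
    refine (UnitAddCircle.norm_coe_le _).trans ?_
    rw [abs_mul, abs_mul, div_eq_mul_inv _ (n : ℝ)]
    have : |(n : ℝ) ^ e / n ^ d| ≤ (n : ℝ)⁻¹ := by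
      rw [abs_of_nonneg (by positivity), div_le_iff₀ (by positivity)]
      obtain ⟨f, rfl⟩ := Nat.exists_eq_add_of_lt h
      rw [pow_succ, mul_comm _ (n : ℝ), ← mul_assoc, inv_mul_cancel₀ (by positivity), one_mul]
      exact pow_le_pow_right₀ hn1 (by omega)
    gcongr
    exact mul_le_of_le_one_left (abs_nonneg _) ht

lemma norm_coe_eval_mul_increment_sub_le (hqn : q ∣ n) (hn : 0 < n)
    (ht : |(t / q : ℝ)| ≤ 1) {P : ℤ[X]} (hP : P.natDegree ≤ D) :
    ‖(((P.eval (n : ℤ) : ℤ) * increment q D y n t -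
        t * (∑ e ∈ Finset.range (D + 1), P.coeff e * y e : ℤ) / q : ℝ) : UnitAddCircle)‖ ≤
      (∑ e ∈ Finset.range (D + 1), |(P.coeff e : ℝ)|) *
        (∑ d ∈ Finset.range (D + 1), |(y d : ℝ)|) / n := by
  have hsum : ((P.eval (n : ℤ) : ℤ) * increment q D y n t -
        t * (∑ e ∈ Finset.range (D + 1), P.coeff e * y e : ℤ) / q : ℝ) =
      ∑ e ∈ Finset.range (D + 1),
        (P.coeff e) • ((n : ℝ) ^ e * increment q D y n t - t * y e / q) := by
    rw [eval_eq_sum_range' (Nat.lt_succ_of_le hP)]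
    push_cast
    rw [Finset.sum_mul, Finset.mul_sum, Finset.sum_div, ← Finset.sum_sub_distrib]
    refine Finset.sum_congr rfl fun e _ => ?_
    rw [zsmul_eq_mul]
    ring
  rw [hsum, mul_div_assoc, Finset.sum_mul]
  change ‖(QuotientAddGroup.mk' _) (∑ d ∈ Finset.range (D + 1), _)‖ ≤ _
  rw [map_sum]
  refine norm_sum_le_of_le _ fun e he => ?_
  rw [map_zsmul]
  refine (norm_zsmul_le _ _).trans ?_
  rw [Int.norm_eq_abs]
  gcongr
  exact norm_coe_pow_mul_increment_sub_le hqn hn ht (by simpa [Nat.lt_succ_iff] using he)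

end increment

/-- Applied with `q ∣ s`: shifting the argument by the earlier terms does not change the main term
modulo 1. -/
lemma Polynomial.dvd_coeff_taylor_sub_coeff (s : ℤ) (p : ℤ[X]) (e : ℕ) :
    s ∣ (taylor s p).coeff e - p.coeff e := by
  rw [taylor_coeff]
  have h := (hasseDeriv e p).sub_dvd_eval_sub s 0
  rw [sub_zero] at h
  have h0 : (hasseDeriv e p).eval 0 = p.coeff e := by
    rw [← taylor_coeff, taylor_zero]
  rwa [h0] at h

lemma norm_coe_eval_add_mul_increment_sub_le {q D n s : ℕ} {y : ℕ → ℤ} {t : ℤ} {p : ℤ[X]}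
    (hqn : q ∣ n) (hn : 0 < n) (ht : |(t / q : ℝ)| ≤ 1) (hp : p.natDegree ≤ D) (hqs : q ∣ s) :
    ‖(((p.eval (s + n : ℤ) : ℤ) * increment q D y n t -
        t * (∑ e ∈ Finset.range (D + 1), p.coeff e * y e : ℤ) / q : ℝ) : UnitAddCircle)‖ ≤
      (∑ e ∈ Finset.range (D + 1), |((taylor (s : ℤ) p).coeff e : ℝ)|) *
        (∑ d ∈ Finset.range (D + 1), |(y d : ℝ)|) / n := by
  have h := norm_coe_eval_mul_increment_sub_le (y := y) (D := D) hqn hn ht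
    (P := taylor (s : ℤ) p) (by rwa [natDegree_taylor])
  rw [taylor_eval, add_comm (n : ℤ)] at h
  refine le_of_eq_of_le (congrArg _ ?_) h
  rw [← sub_eq_zero, ← AddCircle.coe_sub]
  have hdvd : (q : ℤ) ∣ t * ∑ e ∈ Finset.range (D + 1), (taylor (s : ℤ) p).coeff e * y e -
      t * ∑ e ∈ Finset.range (D + 1), p.coeff e * y e := by
    rw [← mul_sub, ← Finset.sum_sub_distrib]
    refine Dvd.dvd.mul_left (Finset.dvd_sum fun e _ => ?_) _
    rw [← sub_mul]
    exact Dvd.dvd.mul_right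
      ((Int.natCast_dvd_natCast.2 hqs).trans (dvd_coeff_taylor_sub_coeff _ _ _)) _
  rw [← UnitAddCircle.coe_eq_zero_of_dvd hdvd]
  congr 1
  push_cast
  ring

/-- For fixed `k`, the sum over `α` splits at `k`. Later terms vanish modulo 1 by divisibility, and
earlier ones form a shift `s` whose effect is absorbed by the growth of `n k`. -/
theorem exists_seq_increment_approx {ι : Type*} [Fintype ι] (p : ι → ℤ[X]) {q D : ℕ}
    (hq : 2 ≤ q) (hD : 1 ≤ D) (hp : ∀ j, (p j).natDegree ≤ D) {y : ℕ → ℤ} (hy : y 0 = 0)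
    {N : ℕ} (hN : 0 < N) :
    ∃ n : ℕ → ℕ, StrictMono n ∧
      (∀ (k : ℕ) (t : ℤ), |(t / q : ℝ)| ≤ 1 → |increment q D y (n k) t| ≤ (1 / 2) ^ k) ∧
      ∀ (α : Finset ℕ) (j : ι) (k : ℕ) (t : ℤ), |(t / q : ℝ)| ≤ 1 →
        ‖((((p j).eval (∑ i ∈ α, (n i : ℤ)) : ℤ) * increment q D y (n k) t -
          (if k ∈ α then
            t * (∑ e ∈ Finset.range (D + 1), (p j).coeff e * y e : ℤ) / q else 0 : ℝ) : ℝ) :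
            UnitAddCircle)‖ ≤ 1 / N * (1 / 2) ^ k := by
  set Y : ℕ := ∑ d ∈ Finset.range (D + 1), (y d).natAbs with hY
  have hYr : (Y : ℝ) = ∑ d ∈ Finset.range (D + 1), |(y d : ℝ)| := by
    rw [hY]; push_cast; simp
  -- The Taylor coefficients control the error when `k ∈ α`, the value at `s` when `k ∉ α`.
  let B : ι → ℕ → ℕ := fun j s =>
    (∑ e ∈ Finset.range (D + 1), ((taylor (s : ℤ) (p j)).coeff e).natAbs) +
      ((p j).eval (s : ℤ)).natAbs
  obtain ⟨n, hmono, hpos, hqn, hdvd, hgrow⟩ := exists_fast_growing_seq q D hq hD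
    fun S => Y + N * Y * ∑ j, ∑ s ∈ Finset.range (S + 1), B j s
  have hq0 : 0 < q := by omega
  have hN' : (0 : ℝ) < N := by exact_mod_cast hN
  have hYle : ∀ k, (Y : ℝ) / n k ≤ (1 / 2) ^ k := by
    intro k
    have hk : (0 : ℝ) < n k := by exact_mod_cast hpos k
    have h := (Nat.mul_le_mul_left (2 ^ k) (Nat.le_add_right Y _)).trans (hgrow k)
    have h' : (2 : ℝ) ^ k * Y ≤ n k := by exact_mod_cast h
    rw [div_le_iff₀ hk, one_div, inv_pow, ← div_eq_inv_mul, le_div_iff₀ (by positivity)]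
    linarith
  have hBle : ∀ j k s, s ≤ ∑ i ∈ Finset.range k, n i →
      (B j s : ℝ) * Y / n k ≤ 1 / N * (1 / 2) ^ k := by
    intro j k s hs
    have hk : (0 : ℝ) < n k := by exact_mod_cast hpos k
    have h1 : B j s ≤ ∑ j, ∑ s ∈ Finset.range (∑ i ∈ Finset.range k, n i + 1), B j s :=
      (Finset.single_le_sum (f := fun s => B j s) (fun _ _ => Nat.zero_le _)
        (Finset.mem_range.2 (Nat.lt_succ_of_le hs))).trans
        (Finset.single_le_sum (f := fun j => ∑ s ∈ Finset.range _, B j s)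
          (fun _ _ => Nat.zero_le _) (Finset.mem_univ j))
    have h2 := (Nat.mul_le_mul_left (2 ^ k)
      ((Nat.mul_le_mul_left (N * Y) h1).trans (Nat.le_add_left _ Y))).trans (hgrow k)
    have h' : (2 : ℝ) ^ k * (N * Y * B j s) ≤ n k := by exact_mod_cast h2
    rw [div_le_iff₀ hk, one_div, one_div, inv_pow, ← mul_inv, ← div_eq_inv_mul,
      le_div_iff₀ (by positivity)]
    linarith
  have hinc : ∀ (k : ℕ) (t : ℤ), |(t / q : ℝ)| ≤ 1 → |increment q D y (n k) t| ≤ Y / n k :=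
    fun k t ht => hYr ▸ abs_increment_le hy (hpos k) ht
  refine ⟨n, hmono, fun k t ht => (hinc k t ht).trans (hYle k), fun α j k t ht => ?_⟩
  set s : ℕ := ∑ i ∈ α with i < k, n i with hs
  have hqs : q ∣ s := Finset.dvd_sum fun i _ => hqn i
  have hsle : s ≤ ∑ i ∈ Finset.range k, n i :=
    Finset.sum_le_sum_of_subset fun i hi => by simpa using (Finset.mem_filter.1 hi).2
  set m : ℤ := s + if k ∈ α then (n k : ℤ) else 0 with hm
  have hsum : ∑ i ∈ α, (n i : ℤ) = m + ∑ i ∈ α with k < i, (n i : ℤ) := by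
    have h1 : (if k ∈ α then (n k : ℤ) else 0) = ∑ i ∈ α with i = k, (n i : ℤ) := by
      rw [Finset.sum_filter, Finset.sum_ite_eq']
    rw [hm, h1, hs, Nat.cast_sum, Finset.sum_filter, Finset.sum_filter, Finset.sum_filter,
      ← Finset.sum_add_distrib, ← Finset.sum_add_distrib]
    refine Finset.sum_congr rfl fun i _ => ?_
    rcases lt_trichotomy i k with h | h | h
    · simp [h, h.ne, h.not_gt]
    · simp [h]
    · simp [h, h.ne', h.not_gt]
  have hlater : (q : ℤ) * (n k : ℤ) ^ D ∣ ∑ i ∈ α with k < i, (n i : ℤ) := by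
    refine Finset.dvd_sum fun i hi => ?_
    obtain ⟨l, rfl⟩ := Nat.exists_eq_add_of_lt (Finset.mem_filter.1 hi).2
    have : q * n k ^ D ∣ n (k + l + 1) := by
      refine (mul_dvd_mul_left q (pow_dvd_pow_of_dvd ?_ D)).trans (hdvd (k + l))
      clear_value m s
      clear hi
      induction l with
      | zero => exact dvd_rfl
      | succ l ih =>
        refine ih.trans (((dvd_pow_self _ (by omega)).trans (dvd_mul_left _ q)).trans
          (hdvd (k + l)))
    exact_mod_cast this
  have hred : ((((p j).eval (∑ i ∈ α, (n i : ℤ)) : ℤ) * increment q D y (n k) t : ℝ) :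
      UnitAddCircle) = (((p j).eval m : ℤ) * increment q D y (n k) t : ℝ) := by
    rw [← sub_eq_zero, ← AddCircle.coe_sub, ← sub_mul, ← Int.cast_sub]
    refine coe_mul_increment_eq_zero hq0 (hpos k) (hlater.trans ?_)
    have := (p j).sub_dvd_eval_sub (∑ i ∈ α, (n i : ℤ)) m
    rwa [hsum, add_sub_cancel_left, ← hsum] at this
  rw [AddCircle.coe_sub, hred, ← AddCircle.coe_sub]
  refine le_trans ?_ (hBle j k s hsle)
  have hBr : (B j s : ℝ) =
      (∑ e ∈ Finset.range (D + 1), |((taylor (s : ℤ) (p j)).coeff e : ℝ)|) +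
        |(((p j).eval (s : ℤ) : ℤ) : ℝ)| := by
    simp only [B]; push_cast; simp
  by_cases hk : k ∈ α
  · rw [if_pos hk, hm, if_pos hk]
    refine (norm_coe_eval_add_mul_increment_sub_le (hqn k) (hpos k) ht (hp j) hqs).trans ?_
    rw [← hYr, hBr]
    gcongr
    exact le_add_of_nonneg_right (abs_nonneg _)
  · rw [if_neg hk, hm, if_neg hk, add_zero, sub_zero]
    refine (UnitAddCircle.norm_coe_le _).trans ?_
    rw [abs_mul, mul_div_assoc, hBr]
    gcongr
    · exact le_add_of_nonneg_left (Finset.sum_nonneg fun _ _ => abs_nonneg _)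
    · exact hinc k t ht

/-! ### Prescribing a functional on the polynomials -/

/-- Linearly independent integer polynomials admit a linear functional, with integer values on
monomials, taking prescribed values up to a common positive factor. -/
theorem exists_functional_of_linearIndependent {ι : Type*} {p : ι → ℤ[X]}
    (hind : LinearIndependent ℤ p) (hzero : ∀ j, (p j).coeff 0 = 0) {D : ℕ}
    (hp : ∀ j, (p j).natDegree ≤ D) (c : ι → ℤ) :
    ∃ (y : ℕ → ℤ) (g : ℤ), 0 < g ∧ y 0 = 0 ∧
      ∀ j, ∑ e ∈ Finset.range (D + 1), (p j).coeff e * y e = g * c j := by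
  let f : ℤ[X] →ₗ[ℤ] ℚ[X] := (mapRingHom (Int.castRingHom ℚ)).toAddMonoidHom.toIntLinearMap
  have hf : ∀ P, f P = P.map (Int.castRingHom ℚ) := fun _ => rfl
  have hindQ : LinearIndependent ℚ fun j => (p j).map (Int.castRingHom ℚ) := by
    rw [← LinearIndependent.iff_fractionRing ℤ ℚ]
    exact hind.map' f (LinearMap.ker_eq_bot.2 (map_injective _ Int.cast_injective))
  obtain ⟨φ, hφ⟩ : ∃ φ : ℚ[X] →ₗ[ℚ] ℚ, ∀ j, φ ((p j).map (Int.castRingHom ℚ)) = c j := by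
    let b := Module.Basis.span hindQ
    obtain ⟨φ, hφ⟩ := (b.constr ℚ fun j => (c j : ℚ)).exists_extend
    refine ⟨φ, fun j => ?_⟩
    have h := LinearMap.congr_fun hφ (b j)
    rw [b.constr_basis] at h
    rw [← h, LinearMap.comp_apply, Submodule.subtype_apply, Module.Basis.span_apply]
  obtain ⟨g, hg⟩ := IsLocalization.exist_integer_multiples (nonZeroDivisors ℤ)
    (Finset.range (D + 1)) fun d => φ (X ^ d)
  have hg0 : (g : ℤ) ≠ 0 := nonZeroDivisors.coe_ne_zero g
  choose! z hz using hg
  -- The denominator `g` may be negative, so its square is used. Setting `y 0 = 0` is harmless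
  -- because the constant terms vanish.
  refine ⟨fun d => if d = 0 then 0 else g * z d, g * g, mul_self_pos.2 hg0, if_pos rfl,
    fun j => ?_⟩
  have hzr : ∀ d ∈ Finset.range (D + 1), (z d : ℚ) = g * φ (X ^ d) := fun d hd => by
    simpa [Submonoid.smul_def] using hz d hd
  have hexp : (c j : ℚ) = ∑ e ∈ Finset.range (D + 1), ((p j).coeff e : ℚ) * φ (X ^ e) := by
    rw [← hφ j, as_sum_range' ((p j).map (Int.castRingHom ℚ)) (D + 1)
      (Nat.lt_succ_of_le (natDegree_map_le.trans (hp j))), map_sum]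
    refine Finset.sum_congr rfl fun e _ => ?_
    rw [← smul_X_eq_monomial, map_smul, smul_eq_mul, coeff_map, eq_intCast]
  have : ((∑ e ∈ Finset.range (D + 1), (p j).coeff e * (if e = 0 then 0 else g * z e) : ℤ) : ℚ)
      = ((g * g * c j : ℤ) : ℚ) := by
    push_cast
    rw [hexp, Finset.mul_sum]
    refine Finset.sum_congr rfl fun e he => ?_
    by_cases h0 : e = 0
    · simp [h0, hzero]
    · rw [if_neg h0, hzr e he]
      ring
  exact_mod_cast this

/-! ### Skew rotations, equidistribution and random arcs -/

section skewRotation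

variable {Ω G : Type*} [MeasurableSpace Ω] [MeasurableSpace G] [AddGroup G] [MeasurableAdd₂ G]
  [MeasurableNeg G]

/-- The skew rotation `(ξ, w) ↦ (ξ, w + θ ξ)`. -/
def skewRotation (θ : Ω → G) (hθ : Measurable θ) : Ω × G ≃ᵐ Ω × G where
  toFun x := (x.1, x.2 + θ x.1)
  invFun x := (x.1, x.2 + -θ x.1)
  left_inv x := by simp
  right_inv x := by simp
  measurable_toFun := measurable_fst.prodMk (measurable_snd.add (hθ.comp measurable_fst))
  measurable_invFun := measurable_fst.prodMk (measurable_snd.add (hθ.comp measurable_fst).neg)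

lemma skewRotation_zpow_apply (θ : Ω → G) (hθ : Measurable θ) (m : ℤ) (x : Ω × G) :
    ((skewRotation θ hθ).toEquiv ^ m : Equiv.Perm (Ω × G)) x = (x.1, x.2 + m • θ x.1) := by
  induction m generalizing x with
  | zero => simp
  | succ m ih =>
    rw [zpow_add_one, Equiv.Perm.mul_apply, ih]
    change (x.1, x.2 + θ x.1 + (m : ℤ) • θ x.1) = _
    rw [add_assoc, add_comm (m : ℤ), add_zsmul, one_zsmul]
  | pred m ih =>
    rw [zpow_sub_one, Equiv.Perm.mul_apply, ih]
    change (x.1, x.2 + -θ x.1 + (-m : ℤ) • θ x.1) = _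
    rw [add_assoc, sub_eq_neg_add, add_zsmul, neg_one_zsmul]

lemma measurePreserving_skewRotation (θ : Ω → G) (hθ : Measurable θ) (μ : Measure Ω)
    (ν : Measure G) [SFinite μ] [SFinite ν] [ν.IsAddRightInvariant] :
    MeasurePreserving (skewRotation θ hθ) (μ.prod ν) (μ.prod ν) :=
  (MeasurePreserving.id μ).skew_product (g := fun a c => c + θ a)
    (measurable_snd.add (hθ.comp measurable_fst))
    (Filter.Eventually.of_forall fun a => map_add_right_eq_self ν (θ a))

end skewRotation

/-- If translation by `e` shifts a `ZMod q`-valued function by one, each of its values is taken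
with probability `1 / q`. -/
lemma measureReal_preimage_zero_of_add_eq {Ω : Type*} [MeasurableSpace Ω] [AddGroup Ω]
    [MeasurableAdd Ω] (μ : Measure Ω) [IsProbabilityMeasure μ] [μ.IsAddRightInvariant]
    {q : ℕ} [NeZero q] {U : Ω → ZMod q} (hU : Measurable U) (e : Ω)
    (he : ∀ ξ, U (ξ + e) = U ξ + 1) : μ (U ⁻¹' {0}) = ENNReal.ofReal (1 / q) := by
  have hshift : ∀ c : ℕ, μ (U ⁻¹' {(c : ZMod q)}) = μ (U ⁻¹' {0}) := by
    intro c
    induction c with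
    | zero => simp
    | succ c ih =>
      rw [← ih, ← measure_preimage_add_right μ e (U ⁻¹' {((c + 1 : ℕ) : ZMod q)})]
      congr 1
      ext ξ
      simp [he]
  have hsum : ∑ c : ZMod q, μ (U ⁻¹' {c}) = 1 := by
    rw [← measure_univ (μ := μ), ← Set.preimage_univ (f := U), ← Finset.coe_univ,
      sum_measure_preimage_singleton _ fun c _ => hU (measurableSet_singleton c)]
  have hconst : ∀ c : ZMod q, μ (U ⁻¹' {c}) = μ (U ⁻¹' {0}) := fun c => by
    rw [← hshift c.val, ZMod.natCast_zmod_val]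
  simp only [hconst, Finset.sum_const, Finset.card_univ, ZMod.card, nsmul_eq_mul] at hsum
  rw [one_div, ENNReal.ofReal_inv_of_pos (by exact_mod_cast NeZero.pos q),
    ENNReal.ofReal_natCast]
  exact ENNReal.eq_inv_of_mul_eq_one_left (by rwa [mul_comm])

section arcs

open Metric

instance UnitAddCircle.isProbabilityMeasure_volume :
    IsProbabilityMeasure (volume : Measure UnitAddCircle) :=
  ⟨by rw [AddCircle.measure_univ, ENNReal.ofReal_one]⟩

lemma UnitAddCircle.volume_closedBall_eq {κ : ℝ} (hκ : κ ≤ 1) (x : UnitAddCircle) :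
    volume (closedBall x (κ / 2)) = ENNReal.ofReal κ := by
  rw [AddCircle.volume_closedBall, mul_div_cancel₀ _ two_ne_zero, min_eq_right hκ]

lemma UnitAddCircle.add_mem_closedBall_zero_iff {w x : UnitAddCircle} {r : ℝ} :
    w + x ∈ closedBall 0 r ↔ w ∈ closedBall (-x) r := by
  rw [mem_closedBall, mem_closedBall, dist_eq_norm, dist_eq_norm, sub_neg_eq_add, sub_zero]

lemma UnitAddCircle.volume_avoid_arc_le {ι : Type*} {κ : ℝ} (h0 : 0 ≤ κ) (hκ : κ ≤ 1)
    (x : ι → UnitAddCircle) (i : ι) :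
    volume {w | ∀ i, w + x i ∉ closedBall 0 (κ / 2)} ≤ ENNReal.ofReal (1 - κ) := by
  calc volume {w | ∀ i, w + x i ∉ closedBall 0 (κ / 2)}
      ≤ volume (closedBall (-x i) (κ / 2))ᶜ := by
        refine measure_mono fun w hw => ?_
        rw [Set.mem_compl_iff, ← add_mem_closedBall_zero_iff]
        exact hw i
    _ = _ := by
        rw [prob_compl_eq_one_sub measurableSet_closedBall, volume_closedBall_eq hκ,
          ENNReal.ofReal_sub _ h0, ENNReal.ofReal_one]

lemma UnitAddCircle.volume_avoid_separated_arcs {ι : Type*} [Fintype ι] {κ : ℝ} (h0 : 0 ≤ κ)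
    (hκ : κ ≤ 1) (x : ι → UnitAddCircle) (hx : ∀ i j, i ≠ j → κ < ‖x i - x j‖) :
    volume {w | ∀ i, w + x i ∉ closedBall 0 (κ / 2)} =
      ENNReal.ofReal (1 - Fintype.card ι * κ) := by
  have hset : {w | ∀ i, w + x i ∉ closedBall 0 (κ / 2)} =
      (⋃ i, closedBall (-x i) (κ / 2))ᶜ := by
    ext w
    simp only [Set.mem_ofPred_eq, Set.mem_compl_iff, Set.mem_iUnion, not_exists,
      add_mem_closedBall_zero_iff]
  rw [hset, prob_compl_eq_one_sub (MeasurableSet.iUnion fun i => measurableSet_closedBall),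
    measure_iUnion _ fun i => measurableSet_closedBall]
  · simp only [volume_closedBall_eq hκ, tsum_fintype, Finset.sum_const, Finset.card_univ,
      nsmul_eq_mul]
    rw [ENNReal.ofReal_sub _ (by positivity), ENNReal.ofReal_one,
      ENNReal.ofReal_mul (by positivity), ENNReal.ofReal_natCast]
  · intro i j hij
    refine closedBall_disjoint_closedBall ?_
    rw [add_halves, dist_eq_norm, neg_sub_neg, norm_sub_rev]
    exact hx i j hij

/-- Random translates of an arc which are disjoint outside of an event of small probability
cover a large part of the circle. -/
lemma measureReal_avoid_random_arcs_le {Ω ι : Type*} [MeasurableSpace Ω] (μ : Measure Ω)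
    [IsProbabilityMeasure μ] [Fintype ι] [Nonempty ι] {κ δ : ℝ} (h0 : 0 ≤ κ)
    (hκ : Fintype.card ι * κ ≤ 1) {x : ι → Ω → UnitAddCircle} (hx : ∀ i, Measurable (x i))
    {E : Set Ω} (hE : MeasurableSet E) (hμE : μ E ≤ ENNReal.ofReal δ) (hδ : 0 ≤ δ)
    (hsep : ∀ ξ ∉ E, ∀ i j, i ≠ j → κ < ‖x i ξ - x j ξ‖) :
    (μ.prod volume).real {v : Ω × UnitAddCircle | ∀ i, v.2 + x i v.1 ∉ closedBall 0 (κ / 2)} ≤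
      1 - Fintype.card ι * κ + (Fintype.card ι - 1) * κ * δ := by
  have hcard : (1 : ℝ) ≤ Fintype.card ι := by exact_mod_cast Fintype.card_pos (α := ι)
  have hκ1 : κ ≤ 1 := (le_mul_of_one_le_left h0 hcard).trans hκ
  have hnn : 0 ≤ (Fintype.card ι - 1) * κ := mul_nonneg (sub_nonneg.2 hcard) h0
  have hmeas : MeasurableSet
      {v : Ω × UnitAddCircle | ∀ i, v.2 + x i v.1 ∉ closedBall 0 (κ / 2)} := by
    simp only [Set.ofPred_forall]
    exact MeasurableSet.iInter fun i =>
      ((measurable_snd.add ((hx i).comp measurable_fst)) measurableSet_closedBall).compl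
  refine ENNReal.toReal_le_of_le_ofReal (by nlinarith [mul_nonneg hnn hδ]) ?_
  rw [Measure.prod_apply hmeas]
  calc ∫⁻ ξ, volume (Prod.mk ξ ⁻¹'
        {v : Ω × UnitAddCircle | ∀ i, v.2 + x i v.1 ∉ closedBall 0 (κ / 2)}) ∂μ
      ≤ ∫⁻ ξ, ENNReal.ofReal (1 - Fintype.card ι * κ) +
          E.indicator (fun _ => ENNReal.ofReal ((Fintype.card ι - 1) * κ)) ξ ∂μ := by
        refine lintegral_mono fun ξ => ?_
        change volume {w | ∀ i, w + x i ξ ∉ closedBall 0 (κ / 2)} ≤ _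
        -- On `E` a single arc is still avoided, and `1 - κ` exceeds the generic value by `(card ι -
        -- 1) * κ`.
        by_cases hξ : ξ ∈ E
        · rw [Set.indicator_of_mem hξ, ← ENNReal.ofReal_add (by linarith) hnn]
          refine (UnitAddCircle.volume_avoid_arc_le h0 hκ1 (fun i => x i ξ)
            (Classical.arbitrary ι)).trans (le_of_eq ?_)
          congr 1
          ring
        · rw [Set.indicator_of_notMem hξ, add_zero]
          exact (UnitAddCircle.volume_avoid_separated_arcs h0 hκ1 (fun i => x i ξ)
            (hsep ξ hξ)).le
    _ = ENNReal.ofReal (1 - Fintype.card ι * κ) +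
          ENNReal.ofReal ((Fintype.card ι - 1) * κ) * μ E := by
        rw [lintegral_add_left measurable_const, lintegral_const, measure_univ, mul_one,
          lintegral_indicator_const hE]
    _ ≤ _ := by
        rw [ENNReal.ofReal_add (by linarith) (mul_nonneg hnn hδ), ENNReal.ofReal_mul hnn]
        gcongr

end arcs

/-! ### Choice of the arc length -/

/-- At `κ = 1 / q` the left side factors as `(1 - κ) * (1 - ℓ * κ)`, so the strict Bernoulli
inequality, valid as `ℓ ≥ 2`, applies. Continuity gives a smaller `κ`. -/
lemma exists_arc_length {ℓ q : ℕ} (hℓ : 2 ≤ ℓ) (hq : ℓ < q) :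
    ∃ κ : ℝ, 0 < κ ∧ κ < 1 / q ∧
      1 - (ℓ + 1) * κ + ℓ * κ * (1 / q) < (1 - κ) ^ (ℓ + 1) := by
  have hq1 : (1 : ℝ) < q := by exact_mod_cast (by omega : 1 < q)
  have hinv : (1 / q : ℝ) < 1 := by rw [div_lt_one (by linarith)]; exact hq1
  have hinv0 : (0 : ℝ) < 1 / q := by positivity
  have hbern : 1 - ℓ * (1 / q : ℝ) < (1 - 1 / q) ^ ℓ := by
    have h := one_add_mul_self_lt_rpow_one_add (s := -(1 / q : ℝ)) (by linarith)
      (by linarith) (p := ℓ) (by exact_mod_cast (by omega : 1 < ℓ))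
    rw [Real.rpow_natCast] at h
    rwa [← sub_eq_add_neg, mul_neg, ← sub_eq_add_neg] at h
  have hev : ∀ᶠ κ : ℝ in nhdsWithin (1 / q : ℝ) (Set.Iio (1 / q)),
      1 - (ℓ + 1) * κ + ℓ * κ * (1 / q) < (1 - κ) ^ (ℓ + 1) := by
    refine Filter.Eventually.filter_mono nhdsWithin_le_nhds ?_
    refine ContinuousAt.eventually_lt (by fun_prop) (by fun_prop) ?_
    rw [pow_succ]
    nlinarith
  have hlt : ∀ᶠ κ : ℝ in nhdsWithin (1 / q : ℝ) (Set.Iio (1 / q)), κ < 1 / q :=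
    self_mem_nhdsWithin
  have hgt : ∀ᶠ κ : ℝ in nhdsWithin (1 / q : ℝ) (Set.Iio (1 / q)), 0 < κ :=
    Filter.Eventually.filter_mono nhdsWithin_le_nhds (Ioi_mem_nhds hinv0)
  obtain ⟨κ, h1, h2, h3⟩ := (hgt.and (hlt.and hev)).exists
  exact ⟨κ, h1, h2, h3⟩

/-! ### The random rotation number -/

section randomRotation

variable (q D : ℕ) (y : ℕ → ℤ) (n : ℕ → ℕ)

/-- The random rotation number with independent increments. -/
noncomputable def randomRotation (ξ : ℕ → ZMod q) : ℝ :=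
  ∑' k, increment q D y (n k) (ξ k).val

variable {q D y n} [NeZero q]

lemma abs_val_div_le_one (a : ZMod q) : |(((a.val : ℤ) : ℝ) / q)| ≤ 1 := by
  rw [Int.cast_natCast, abs_of_nonneg (by positivity)]
  exact div_le_one_of_le₀ (by exact_mod_cast a.val_lt.le) (Nat.cast_nonneg _)

variable (hbound : ∀ (k : ℕ) (t : ℤ), |(t / q : ℝ)| ≤ 1 →
  |increment q D y (n k) t| ≤ (1 / 2) ^ k)
include hbound

lemma continuous_randomRotation : Continuous (randomRotation q D y n) := by
  refine continuous_tsum (fun k => ?_) summable_geometric_two fun k ξ =>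
    hbound k _ (abs_val_div_le_one (ξ k))
  exact (continuous_of_discreteTopology
    (f := fun a : ZMod q => increment q D y (n k) a.val)).comp (continuous_apply k)

lemma hasSum_randomRotation (ξ : ℕ → ZMod q) :
    HasSum (fun k => increment q D y (n k) (ξ k).val) (randomRotation q D y n ξ) :=
  (Summable.of_norm_bounded summable_geometric_two fun k =>
    hbound k _ (abs_val_div_le_one (ξ k))).hasSum

lemma norm_coe_mul_randomRotation_sub_le {α : Finset ℕ} {m C : ℤ} {η : ℝ}
    (happrox : ∀ (k : ℕ) (t : ℤ), |(t / q : ℝ)| ≤ 1 →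
      ‖((m * increment q D y (n k) t - (if k ∈ α then t * C / q else 0 : ℝ) : ℝ) :
        UnitAddCircle)‖ ≤ η * (1 / 2) ^ k) (ξ : ℕ → ZMod q) :
    ‖((m * randomRotation q D y n ξ - (∑ k ∈ α, ((ξ k).val : ℤ) : ℤ) * C / q : ℝ) :
      UnitAddCircle)‖ ≤ 2 * η := by
  have h1 : HasSum (fun k => if k ∈ α then (((ξ k).val : ℤ) : ℝ) * C / q else 0)
      ((∑ k ∈ α, ((ξ k).val : ℤ) : ℤ) * C / q) := by
    have := hasSum_sum_of_ne_finset_zero (L := SummationFilter.unconditional ℕ) (f := fun k =>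
      if k ∈ α then (((ξ k).val : ℤ) : ℝ) * C / q else 0) (s := α) fun k hk => if_neg hk
    convert this using 1
    rw [Int.cast_sum, Finset.sum_mul, Finset.sum_div]
    exact Finset.sum_congr rfl fun k hk => (if_pos hk).symm
  have h2 := (((hasSum_randomRotation hbound ξ).mul_left (m : ℝ)).sub h1).map
    (QuotientAddGroup.mk' (AddSubgroup.zmultiples (1 : ℝ))) (AddCircle.continuous_mk' 1)
  rw [mul_comm 2]
  exact h2.norm_le_of_bounded (hasSum_geometric_two.mul_left η) fun k =>
    happrox k _ (abs_val_div_le_one (ξ k))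

end randomRotation

/-! ### The counterexample -/

theorem corollary0 (ℓ : ℕ) (hℓ : 2 ≤ ℓ) (p : Fin ℓ → ℤ[X])
    (hzero : ∀ j, (p j).coeff 0 = 0) (hind : LinearIndependent ℤ p) :
    ∃ (X : Type) (_ : MeasurableSpace X) (ν : Measure X) (T : X ≃ᵐ X) (A : Set X) (ε : ℝ),
      IsProbabilityMeasure ν ∧ MeasurePreserving T ν ν ∧
      MeasurableSet A ∧ 0 < ν A ∧ 0 < ε ∧
      ¬ IsIPStar (largeReturns ν T p A ε) := by
  obtain ⟨D, hD1, hD⟩ : ∃ D, 1 ≤ D ∧ ∀ j, (p j).natDegree ≤ D :=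
    ⟨1 + ∑ j, (p j).natDegree, Nat.le_add_right _ _, fun j =>
      (Finset.single_le_sum (f := fun j => (p j).natDegree) (fun _ _ => Nat.zero_le _)
        (Finset.mem_univ j)).trans (Nat.le_add_left _ _)⟩
  obtain ⟨y, g, hg, hy, hC⟩ :=
    exists_functional_of_linearIndependent hind hzero hD fun j => ((j : ℕ) : ℤ) + 1
  -- This size makes `g` and all differences of the values `0, …, ℓ` invertible modulo `q`.
  obtain ⟨q, hqge, hqp⟩ := Nat.exists_infinite_primes (ℓ + g.natAbs + 1)
  have : Fact q.Prime := ⟨hqp⟩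
  have hq0 : (0 : ℝ) < q := by exact_mod_cast hqp.pos
  obtain ⟨κ, hκ0, hκq, hκ⟩ := exists_arc_length (q := q) hℓ (by omega)
  have hκ1 : κ < 1 :=
    hκq.trans_le (div_le_one_of_le₀ (by exact_mod_cast hqp.one_lt.le) hq0.le)
  -- Each of the two points compared in `hsep` carries an error `2 / N`.
  obtain ⟨N, hN0, hN⟩ : ∃ N : ℕ, 0 < N ∧ κ + 4 * (1 / N : ℝ) < 1 / q := by
    obtain ⟨N, hN⟩ := exists_nat_one_div_lt (show 0 < (1 / q - κ) / 4 by linarith)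
    exact ⟨N + 1, N.succ_pos, by push_cast; linarith⟩
  obtain ⟨n, hmono, hbound, happrox⟩ :=
    exists_seq_increment_approx p hqp.two_le hD1 hD hy hN0
  let θ : (ℕ → ZMod q) → UnitAddCircle := fun ξ => (randomRotation q D y n ξ : ℝ)
  have hθ : Measurable θ :=
    ((AddCircle.continuous_mk' 1).comp (continuous_randomRotation hbound)).measurable
  let μ : Measure (ℕ → ZMod q) := Measure.addHaarMeasure ⊤
  have hμ : IsProbabilityMeasure μ := ⟨Measure.addHaarMeasure_self⟩
  let A : Set ((ℕ → ZMod q) × UnitAddCircle) := {v | v.2 ∉ Metric.closedBall 0 (κ / 2)}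
  have hA : MeasurableSet A := (measurable_snd measurableSet_closedBall).compl
  have hνA : (μ.prod volume) A = ENNReal.ofReal (1 - κ) := by
    have : A = Set.univ ×ˢ (Metric.closedBall 0 (κ / 2))ᶜ := by ext; simp [A]
    rw [this, Measure.prod_prod, measure_univ, one_mul,
      prob_compl_eq_one_sub measurableSet_closedBall,
      UnitAddCircle.volume_closedBall_eq hκ1.le, ENNReal.ofReal_sub _ hκ0.le,
      ENNReal.ofReal_one]
  refine ⟨(ℕ → ZMod q) × UnitAddCircle, inferInstance, μ.prod volume, skewRotation θ hθ, A,
    (1 - κ) ^ (ℓ + 1) - (1 - (ℓ + 1) * κ + ℓ * κ * (1 / q)), inferInstance,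
    measurePreserving_skewRotation θ hθ μ volume, hA, ?_, sub_pos.2 hκ, fun hIP => ?_⟩
  · rw [hνA]
    exact ENNReal.ofReal_pos.2 (by linarith)
  obtain ⟨_, hm, α, hα, rfl⟩ := hIP (fun k => (n k : ℤ))
    (Or.inl fun a b hab => Int.ofNat_lt.2 (hmono hab))
  rw [largeReturns, Set.mem_ofPred_eq] at hm
  refine hm.not_ge ?_
  -- The index `none` stands for the untranslated copy of `A`.
  let c : Option (Fin ℓ) → ℤ := fun i => i.elim 0 fun j => (j : ℕ) + 1
  let m : Option (Fin ℓ) → ℤ := fun i => i.elim 0 fun j => (p j).eval (∑ k ∈ α, (n k : ℤ))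
  let U : (ℕ → ZMod q) → ZMod q := fun ξ => ∑ k ∈ α, ξ k
  have hU : Measurable U := by fun_prop
  obtain ⟨k₀, hk₀⟩ := hα
  -- As `α` is nonempty, adding 1 to one coordinate in `α` shifts `U` by 1, so `U` is uniform.
  have hUμ : μ (U ⁻¹' {0}) = ENNReal.ofReal (1 / q) :=
    measureReal_preimage_zero_of_add_eq μ hU (Pi.single k₀ 1) fun ξ => by
      simp [U, Finset.sum_add_distrib, Finset.sum_pi_single', hk₀]
  have hclose : ∀ i ξ, ‖m i • θ ξ -
      ((((∑ k ∈ α, ((ξ k).val : ℤ) : ℤ) * (g * c i : ℤ)) / q : ℝ) : UnitAddCircle)‖ ≤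
      2 * (1 / N) := by
    intro i ξ
    cases i with
    | none => simp [m, c]
    | some j =>
      have h := norm_coe_mul_randomRotation_sub_le hbound (happrox α j) ξ
      rw [hC j] at h
      rwa [AddCircle.coe_sub, ← zsmul_eq_mul, AddCircle.coe_zsmul] at h
  have hsep : ∀ ξ ∉ U ⁻¹' {0}, ∀ i j, i ≠ j → κ < ‖m i • θ ξ - m j • θ ξ‖ := by
    intro ξ hξ i j hij
    set u : ℤ := ∑ k ∈ α, ((ξ k).val : ℤ) with hu
    have hprime : Prime (q : ℤ) := Nat.prime_iff_prime_int.1 hqp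
    have hndvd : ¬ (q : ℤ) ∣ u * (g * c i) - u * (g * c j) := by
      rw [← mul_sub, ← mul_sub, hprime.dvd_mul, hprime.dvd_mul, not_or, not_or]
      refine ⟨fun h => hξ ?_, fun h => ?_, fun h => ?_⟩
      · rw [← ZMod.intCast_zmod_eq_zero_iff_dvd, hu] at h
        simpa [U] using h
      · have := Int.le_of_dvd hg h
        omega
      · have hlt : (c i - c j).natAbs < q := by
          cases i <;> cases j <;> simp only [c, Option.elim] <;> omega
        have h0 := Int.eq_zero_of_dvd_of_natAbs_lt_natAbs h (by simpa using hlt)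
        cases i <;> cases j <;> simp only [c, Option.elim] at h0
        · exact hij rfl
        · omega
        · omega
        · exact hij (congrArg some (Fin.ext (by omega)))
    have h1 := UnitAddCircle.inv_le_norm_coe (by exact_mod_cast hqp.pos) hndvd
    have h2 : (((u * (g * c i) - u * (g * c j) : ℤ) / (q : ℤ) : ℝ) : UnitAddCircle) =
        ((u * (g * c i : ℤ) / q : ℝ) : UnitAddCircle) -
          ((u * (g * c j : ℤ) / q : ℝ) : UnitAddCircle) := by
      rw [← AddCircle.coe_sub]
      congr 1
      push_cast
      ring
    rw [h2, Int.cast_natCast] at h1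
    have h3 := hclose i ξ
    have h4 := hclose j ξ
    rw [← hu] at h3 h4
    rw [norm_sub_rev] at h3
    have h5 := norm_add₃_le (a := ((u * (g * c i : ℤ) / q : ℝ) : UnitAddCircle) - m i • θ ξ)
      (b := m i • θ ξ - m j • θ ξ)
      (c := m j • θ ξ - ((u * (g * c j : ℤ) / q : ℝ) : UnitAddCircle))
    rw [sub_add_sub_cancel, sub_add_sub_cancel] at h5
    linarith
  have hcard : (Fintype.card (Option (Fin ℓ)) : ℝ) = ℓ + 1 := by simp
  have hset : (A ∩ ⋂ j : Fin ℓ,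
      iteratePreimage (skewRotation θ hθ) ((p j).eval (∑ k ∈ α, (n k : ℤ))) A) =
      {v | ∀ i, v.2 + m i • θ v.1 ∉ Metric.closedBall 0 (κ / 2)} := by
    ext v
    simp only [iteratePreimage, Set.mem_inter_iff, Set.mem_iInter, Set.mem_preimage,
      skewRotation_zpow_apply, A, Set.mem_ofPred_eq, Option.forall, m, Option.elim, zero_smul,
      add_zero]
  rw [hset, measureReal_def (μ.prod volume) A, hνA, ENNReal.toReal_ofReal (by linarith),
    sub_sub_cancel]
  refine (measureReal_avoid_random_arcs_le μ hκ0.le ?_ (fun i => hθ.const_smul (m i))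
    (hU (measurableSet_singleton 0)) hUμ.le (by positivity) hsep).trans_eq ?_
  · rw [hcard]
    have h1 : ((ℓ + 1 : ℕ) : ℝ) ≤ q := by exact_mod_cast (by omega)
    push_cast at h1
    calc (ℓ + 1) * κ ≤ q * (1 / q) := by gcongr
      _ = 1 := by field_simp
  · rw [hcard]
    ring
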